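/- Let $0\le p<1$ and $0\le k<1$, and let $\mathbb D=\{z\in\mathbb C:|z|<1\}$, $\widehat{\mathbb C}=\mathbb C\cup\{\infty\}$. Let $\Sigma(p)$ be the class of univalent (injective) meromorphic functions on $\mathbb D$ that are holomorphic on $\mathbb D\setminus\{p\}$ and have a simple pole with residue $1$ at $p$; every such $f$ has an expansion $f(z)=\frac1{z-p}+\sum_{n=0}^\infty b_nz^n$ in $\mathbb D$. A map $F:\widehat{\mathbb C}\to\widehat{\mathbb C}$ is called $k$-quasiconformal if it is a homeomorphism and has, in the sense of distributions, locally $L^2$ derivatives on $\mathbb C\setminus\{F^{-1}(\infty)\}$ satisfying $|\bar\partial F|\le k\,|\partial F|$ almost everywhere there. Let $\Sigma_k(p)$ be the class of those $f\in\Sigma(p)$ that have a $k$-quasiconformal extension to $\widehat{\mathbb C}$, that is, for which there is a $k$-quasiconformal $F:\widehat{\mathbb C}\to\widehat{\mathbb C}$ with $F=f$ on $\mathbb D$ (so $F(p)=\infty$). If $f\in\Sigma(p)$ satisfies $$|(z-p)^2f'(z)+1|\le \frac{k\,|z-p|^2}{(1+p)^2}\qquad\text{for all } z\in\mathbb D\setminus\{p\},$$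 then $f\in\Sigma_k(p)$. -/

import Mathlib

open MeasureTheory Topology Filter
open scoped ContDiff

noncomputable section

namespace QCExt

/-- The open unit disk `𝔻` of the complex plane. -/
def unitDisk : Set ℂ := Metric.ball 0 1

/-- The extended complex plane, as the one-point compactification of `ℂ`. -/
abbrev Sphere : Type := OnePoint ℂ

/-- The complex-valued representative of a map `F` of the sphere, on the plane. It is meaningful on
`finitePart F`; the value `0` elsewhere is irrelevant. -/
def affine (F : Sphere → Sphere) (z : ℂ) : ℂ := (F (z : Sphere)).elim 0 id

/-- The set `ℂ \ F⁻¹(∞)`. -/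
def finitePart (F : Sphere → Sphere) : Set ℂ := {z : ℂ | F (z : Sphere) ≠ OnePoint.infty}

/-- `h` is the distributional derivative of `g` on the open set `U ⊆ ℂ = ℝ²` in the
direction `v`: `∫ g ∂ᵥφ = - ∫ h φ` for every smooth function `φ` with compact support in `U`. -/
def IsWeakDerivOn (U : Set ℂ) (v : ℂ) (g h : ℂ → ℂ) : Prop :=
  ∀ φ : ℂ → ℝ, ContDiff ℝ ∞ φ → HasCompactSupport φ → tsupport φ ⊆ U →
    ∫ z, (fderiv ℝ φ z v) • g z = - ∫ z, φ z • h z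

/-- `h` is locally square integrable on the open set `U ⊆ ℂ`. -/
def LocallyL2On (h : ℂ → ℂ) (U : Set ℂ) : Prop :=
  ∀ K : Set ℂ, IsCompact K → K ⊆ U → MemLp h 2 (volume.restrict K)

/-- `F` is a `k`-quasiconformal map of the sphere: a homeomorphism that has locally square
integrable distributional derivatives `gx`, `gy` on `ℂ \ F⁻¹(∞)` with `|∂̄F| ≤ k |∂F|` a.e.,
where `∂F = (gx - i gy) / 2` and `∂̄F = (gx + i gy) / 2`. -/
def IsQuasiconformal (k : ℝ) (F : Sphere → Sphere) : Prop :=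
  IsHomeomorph F ∧
  ∃ gx gy : ℂ → ℂ,
    LocallyL2On gx (finitePart F) ∧ LocallyL2On gy (finitePart F) ∧
    IsWeakDerivOn (finitePart F) 1 (affine F) gx ∧
    IsWeakDerivOn (finitePart F) Complex.I (affine F) gy ∧
    ∀ᵐ z ∂(volume.restrict (finitePart F)),
      ‖(gx z + Complex.I * gy z) / 2‖ ≤ k * ‖(gx z - Complex.I * gy z) / 2‖

open Classical in
/-- The sphere-valued map defined by a function `f` with a pole at `p`: it takes the value `∞` at
`p` (the number `f p` plays no role), and the value `f z` at `z ≠ p`. -/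
def withPole (p : ℝ) (f : ℂ → ℂ) (z : ℂ) : Sphere :=
  if z = (p : ℂ) then OnePoint.infty else ((f z : ℂ) : Sphere)

/-- The class `Σ(p)`: univalent meromorphic functions on the unit disk whose only pole is at
`p`, where they have a simple pole with residue `1`. -/
structure InSigma (p : ℝ) (f : ℂ → ℂ) : Prop where
  holomorphic : DifferentiableOn ℂ f (unitDisk \ {(p : ℂ)})
  simple_pole : meromorphicOrderAt f (p : ℂ) = -1
  residue_one : Tendsto (fun z : ℂ => (z - p) * f z) (𝓝[≠] (p : ℂ)) (𝓝 1)
  univalent : Set.InjOn (withPole p f) unitDisk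

/-- The class `Σ_k(p)`: functions in `Σ(p)` that have a `k`-quasiconformal extension to the
sphere. -/
def InSigmaK (k p : ℝ) (f : ℂ → ℂ) : Prop :=
  InSigma p f ∧
    ∃ F : Sphere → Sphere, IsQuasiconformal k F ∧
      ∀ z ∈ unitDisk, F (z : Sphere) = withPole p f z

end QCExt

end

/-!
Write `f z = 1 / (z - p) + g z` with `g` holomorphic on the disk; the hypothesis says exactly that
`‖g'‖ ≤ L` for `L = k / (1 + p) ^ 2`. The disk is convex, so `g` is `L`-Lipschitz and extends with
the same constant to the closed disk. Let `r` be the identity on the closed disk and the reflection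
`1 / conj z` outside it, and set `G = g ∘ r`. The extension of `f` is `F z = 1 / (z - p) + G z`,
with `F p = ∞` and `F ∞ = g 0`.

Everything follows from the elementary inequality
`‖r z - r w‖ * (‖z - p‖ * ‖w - p‖) ≤ (1 + p) ^ 2 * ‖z - w‖` (`norm_reflect_sub_mul_le`). In the
coordinate `ζ = 1 / (z - p)` it says that `F` is `ζ ↦ ζ + u ζ` with `u` a `k`-Lipschitz map
of the whole plane.

* A contraction perturbs the identity to a homeomorphism of the plane, which extends to the sphere
  (`exists_homeomorph_sphere`).
* `G` is Lipschitz, hence differentiable almost everywhere by Rademacher's theorem, and its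
  pointwise derivative is its distributional derivative
  (`integral_fderiv_smul_eq_neg_integral_smul_fderiv`).
* At a point of differentiability, `‖∂G‖ + ‖∂̄G‖` is at most the operator norm of the derivative, so
  it is at most `k / ‖z - p‖ ^ 2`, which is `k` times the norm of the derivative of the polar part.
  As `k < 1`, this gives `‖∂̄F‖ ≤ k * ‖∂F‖`
  (`isQuasiconformal_of_pole_add_lipschitz`); no formula for the derivatives of `G` is needed.
-/

open ComplexConjugate

namespace QCExt

/-! ### The reflection in the unit circle -/

/-- The retraction of the plane onto the closed unit disk which is the reflection `z ↦ 1 / conj z`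
in the unit circle outside the disk. -/
noncomputable def reflect (z : ℂ) : ℂ := if ‖z‖ ≤ 1 then z else (conj z)⁻¹

theorem reflect_of_norm_le {z : ℂ} (hz : ‖z‖ ≤ 1) : reflect z = z := if_pos hz

theorem reflect_of_one_lt_norm {z : ℂ} (hz : 1 < ‖z‖) : reflect z = (conj z)⁻¹ :=
  if_neg hz.not_ge

theorem norm_reflect_le_one (z : ℂ) : ‖reflect z‖ ≤ 1 := by
  rcases le_or_gt ‖z‖ 1 with hz | hz
  · rwa [reflect_of_norm_le hz]
  · rw [reflect_of_one_lt_norm hz, norm_inv, Complex.norm_conj]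
    exact inv_le_one_of_one_le₀ hz.le

/-- Comparison of a point of the closed disk with a reflected point: after squaring, this is
`(1 - ‖z‖ ^ 2) * (‖w‖ ^ 2 - 1) ≥ 0`. -/
theorem norm_sub_inv_conj_mul_le {z w : ℂ} (hz : ‖z‖ ≤ 1) (hw : 1 < ‖w‖) :
    ‖z - (conj w)⁻¹‖ * ‖w‖ ≤ ‖z - w‖ := by
  have hw0 : conj w ≠ 0 := by
    rw [ne_eq, map_eq_zero]; rintro rfl; simp at hw; linarith
  have h1 : ‖z - (conj w)⁻¹‖ * ‖w‖ = ‖z * conj w - 1‖ := by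
    rw [← Complex.norm_conj w, ← norm_mul, sub_mul, inv_mul_cancel₀ hw0]
  rw [h1]
  refine le_of_sq_le_sq ?_ (norm_nonneg _)
  have h2 : ‖z‖ ^ 2 ≤ 1 := pow_le_one₀ (norm_nonneg _) hz
  have h3 : 1 ≤ ‖w‖ ^ 2 := one_le_pow₀ hw.le
  rw [← Complex.normSq_eq_norm_sq, Complex.normSq_apply] at h2 h3 ⊢
  rw [← Complex.normSq_eq_norm_sq, Complex.normSq_apply]
  simp only [Complex.sub_re, Complex.sub_im, Complex.mul_re, Complex.mul_im, Complex.conj_re,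
    Complex.conj_im, Complex.one_re, Complex.one_im]
  nlinarith [mul_nonneg (sub_nonneg.2 h2) (sub_nonneg.2 h3)]

theorem norm_inv_conj_sub {z w : ℂ} (hz : 1 < ‖z‖) (hw : 1 < ‖w‖) :
    ‖(conj z)⁻¹ - (conj w)⁻¹‖ * (‖z‖ * ‖w‖) = ‖z - w‖ := by
  have hz0 : conj z ≠ 0 := by
    rw [ne_eq, map_eq_zero]; rintro rfl; simp at hz; linarith
  have hw0 : conj w ≠ 0 := by
    rw [ne_eq, map_eq_zero]; rintro rfl; simp at hw; linarith
  rw [inv_sub_inv hz0 hw0, norm_div, norm_mul, ← map_sub, Complex.norm_conj, Complex.norm_conj,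
    Complex.norm_conj, norm_sub_rev w z, div_mul_cancel₀]
  positivity

theorem lipschitzWith_reflect : LipschitzWith 1 reflect := by
  have mixed : ∀ {z w : ℂ}, ‖z‖ ≤ 1 → 1 < ‖w‖ → ‖z - (conj w)⁻¹‖ ≤ ‖z - w‖ := fun hz hw =>
    (le_mul_of_one_le_right (norm_nonneg _) hw.le).trans (norm_sub_inv_conj_mul_le hz hw)
  refine LipschitzWith.of_dist_le_mul fun z w => ?_
  rw [NNReal.coe_one, one_mul, dist_eq_norm, dist_eq_norm]
  rcases le_or_gt ‖z‖ 1 with hz | hz <;> rcases le_or_gt ‖w‖ 1 with hw | hw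
  · rw [reflect_of_norm_le hz, reflect_of_norm_le hw]
  · rw [reflect_of_norm_le hz, reflect_of_one_lt_norm hw]
    exact mixed hz hw
  · rw [reflect_of_one_lt_norm hz, reflect_of_norm_le hw, norm_sub_rev, norm_sub_rev z]
    exact mixed hw hz
  · rw [reflect_of_one_lt_norm hz, reflect_of_one_lt_norm hw, ← norm_inv_conj_sub hz hw]
    exact le_mul_of_one_le_right (norm_nonneg _) (one_le_mul_of_one_le_of_one_le hz.le hw.le)

theorem norm_sub_ofReal_le {p : ℝ} (hp : 0 ≤ p) (z : ℂ) : ‖z - p‖ ≤ ‖z‖ + p := by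
  simpa [abs_of_nonneg hp] using norm_sub_le z (p : ℂ)

/-- In the coordinate `1 / (z - p)` the retraction `reflect` is Lipschitz with constant
`(1 + p) ^ 2`. -/
theorem norm_reflect_sub_mul_le {p : ℝ} (hp : 0 ≤ p) (z w : ℂ) :
    ‖reflect z - reflect w‖ * (‖z - p‖ * ‖w - p‖) ≤ (1 + p) ^ 2 * ‖z - w‖ := by
  have inside : ∀ {z : ℂ}, ‖z‖ ≤ 1 → ‖z - p‖ ≤ 1 + p := fun {z} hz => by
    linarith [norm_sub_ofReal_le hp z]
  have outside : ∀ {z : ℂ}, 1 < ‖z‖ → ‖z - p‖ ≤ (1 + p) * ‖z‖ := fun {z} hz => by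
    nlinarith [norm_sub_ofReal_le hp z]
  have mixed : ∀ {z w : ℂ}, ‖z‖ ≤ 1 → 1 < ‖w‖ →
      ‖z - (conj w)⁻¹‖ * (‖z - p‖ * ‖w - p‖) ≤ (1 + p) ^ 2 * ‖z - w‖ := fun {z w} hz hw =>
    calc ‖z - (conj w)⁻¹‖ * (‖z - p‖ * ‖w - p‖)
        ≤ ‖z - (conj w)⁻¹‖ * ((1 + p) * ((1 + p) * ‖w‖)) := by
          gcongr
          exacts [inside hz, outside hw]
      _ = (1 + p) ^ 2 * (‖z - (conj w)⁻¹‖ * ‖w‖) := by ring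
      _ ≤ (1 + p) ^ 2 * ‖z - w‖ := by
          gcongr
          exact norm_sub_inv_conj_mul_le hz hw
  rcases le_or_gt ‖z‖ 1 with hz | hz <;> rcases le_or_gt ‖w‖ 1 with hw | hw
  · rw [reflect_of_norm_le hz, reflect_of_norm_le hw]
    calc ‖z - w‖ * (‖z - p‖ * ‖w - p‖) ≤ ‖z - w‖ * ((1 + p) * (1 + p)) := by
          gcongr
          exacts [inside hz, inside hw]
      _ = (1 + p) ^ 2 * ‖z - w‖ := by ring
  · rw [reflect_of_norm_le hz, reflect_of_one_lt_norm hw]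
    exact mixed hz hw
  · rw [reflect_of_one_lt_norm hz, reflect_of_norm_le hw, norm_sub_rev, norm_sub_rev z w,
      mul_comm ‖z - p‖]
    exact mixed hw hz
  · rw [reflect_of_one_lt_norm hz, reflect_of_one_lt_norm hw, ← norm_inv_conj_sub hz hw]
    calc ‖(conj z)⁻¹ - (conj w)⁻¹‖ * (‖z - p‖ * ‖w - p‖)
        ≤ ‖(conj z)⁻¹ - (conj w)⁻¹‖ * (((1 + p) * ‖z‖) * ((1 + p) * ‖w‖)) := by
          gcongr
          exacts [outside hz, outside hw]
      _ = (1 + p) ^ 2 * (‖(conj z)⁻¹ - (conj w)⁻¹‖ * (‖z‖ * ‖w‖)) := by ring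

/-- The estimate `norm_reflect_sub_mul_le` in the limit `w → ∞`, where `reflect w → 0`. -/
theorem norm_reflect_mul_le {p : ℝ} (hp : 0 ≤ p) (z : ℂ) :
    ‖reflect z‖ * ‖z - p‖ ≤ (1 + p) ^ 2 := by
  have h := norm_sub_ofReal_le hp z
  rcases le_or_gt ‖z‖ 1 with hz | hz
  · rw [reflect_of_norm_le hz]
    nlinarith [norm_nonneg z, norm_nonneg (z - p)]
  · rw [reflect_of_one_lt_norm hz, norm_inv, Complex.norm_conj, inv_mul_le_iff₀ (by linarith)]
    nlinarith [mul_nonneg hp (sub_nonneg.2 hz.le), mul_nonneg (norm_nonneg z) (sq_nonneg p)]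

/-! ### Homeomorphisms of the plane and of the sphere -/

/-- The inversion `z ↦ 1 / z` of the sphere, which exchanges `0` and `∞`. -/
noncomputable def sphereInv : Sphere ≃ₜ Sphere :=
  let i : Sphere → Sphere := fun x => x.elim ((0 : ℂ) : Sphere) fun z =>
    if z = 0 then OnePoint.infty else ((z⁻¹ : ℂ) : Sphere)
  have hi : Function.Involutive i := by
    intro x
    induction x using OnePoint.rec with
    | infty => simp [i]
    | coe z => by_cases hz : z = 0 <;> simp [i, hz]
  have hc : Continuous i := by
    rw [OnePoint.continuous_iff, Filter.coclosedCompact_eq_cocompact,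
      ← Metric.cobounded_eq_cocompact]
    constructor
    · have h : Tendsto (fun z : ℂ => ((z⁻¹ : ℂ) : Sphere)) (Bornology.cobounded ℂ)
          (𝓝 ((0 : ℂ) : Sphere)) :=
        (OnePoint.continuous_coe.tendsto _).comp tendsto_inv₀_cobounded
      refine h.congr' ?_
      filter_upwards [Metric.hasBasis_cobounded_compl_ball (0 : ℂ) |>.mem_of_mem trivial (i := 1)]
        with z hz
      have : z ≠ 0 := by rintro rfl; simp at hz
      simp [i, this]
    · rw [continuous_iff_continuousAt]
      intro z
      by_cases hz : z = 0
      · subst hz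
        rw [continuousAt_iff_punctured_nhds]
        have h : Tendsto (fun z : ℂ => ((z⁻¹ : ℂ) : Sphere)) (𝓝[≠] 0)
            (𝓝 (OnePoint.infty : Sphere)) := by
          refine OnePoint.tendsto_coe_infty.comp ?_
          rw [Filter.coclosedCompact_eq_cocompact, ← Metric.cobounded_eq_cocompact]
          exact tendsto_inv₀_nhdsNE_zero
        have e : i ((0 : ℂ) : Sphere) = OnePoint.infty := by simp [i]
        rw [e]
        refine h.congr' ?_
        filter_upwards [self_mem_nhdsWithin] with z hz
        have : z ≠ 0 := hz
        simp [i, this]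
      · have h : ContinuousAt (fun z : ℂ => ((z⁻¹ : ℂ) : Sphere)) z :=
          OnePoint.continuous_coe.continuousAt.comp (continuousAt_inv₀ hz)
        refine h.congr ?_
        filter_upwards [isOpen_ne.mem_nhds hz] with w hw
        have : w ≠ 0 := hw
        simp [i, this]
  { toFun := i, invFun := i, left_inv := hi, right_inv := hi,
    continuous_toFun := hc, continuous_invFun := hc }

theorem sphereInv_zero : sphereInv ((0 : ℂ) : Sphere) = OnePoint.infty := by
  simp [sphereInv]

theorem sphereInv_coe {z : ℂ} (hz : z ≠ 0) : sphereInv (z : Sphere) = ((z⁻¹ : ℂ) : Sphere) := by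
  simp [sphereInv, hz]

/-- A contraction perturbs the identity of the plane to a homeomorphism. -/
theorem exists_homeomorph_id_add {k : ℝ} (hk1 : k < 1) {u : ℂ → ℂ}
    (hu : ∀ z w, ‖u z - u w‖ ≤ k * ‖z - w‖) : ∃ h : ℂ ≃ₜ ℂ, ∀ z, h z = z + u z := by
  lift k to NNReal using by simpa using (norm_nonneg _).trans (hu 1 0)
  have h : ApproximatesLinearOn (fun z => z + u z)
      ((ContinuousLinearEquiv.refl ℂ ℂ : ℂ ≃L[ℂ] ℂ) : ℂ →L[ℂ] ℂ) Set.univ k := by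
    intro z _ w _
    have e : z + u z - (w + u w) - (z - w) = u z - u w := by ring
    simpa [e] using hu z w
  refine ⟨h.toHomeomorph _ (Or.inr ?_), fun z => rfl⟩
  have hn : ‖(((ContinuousLinearEquiv.refl ℂ ℂ).symm : ℂ ≃L[ℂ] ℂ) : ℂ →L[ℂ] ℂ)‖₊ = 1 :=
    ContinuousLinearMap.nnnorm_id
  rw [hn, inv_one]
  exact_mod_cast hk1

/-- If `G` is `k`-Lipschitz with `k < 1` in the coordinate `1 / (z - p)`, with value `c` at `z = ∞`,
then `z ↦ 1 / (z - p) + G z` extends to a homeomorphism of the sphere. -/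
theorem exists_homeomorph_sphere {p c : ℂ} {k : ℝ} (hk1 : k < 1) {G : ℂ → ℂ}
    (hGp : ∀ z w, ‖G z - G w‖ * (‖z - p‖ * ‖w - p‖) ≤ k * ‖z - w‖)
    (hGc : ∀ z, ‖G z - c‖ * ‖z - p‖ ≤ k) :
    ∃ F : Sphere ≃ₜ Sphere, F (p : Sphere) = OnePoint.infty ∧
      ∀ z : ℂ, z ≠ p → F (z : Sphere) = (((z - p)⁻¹ + G z : ℂ) : Sphere) := by
  classical
  -- The map `G` in the coordinate `w = 1 / (z - p)`; the point `z = ∞` is at `w = 0`.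
  set u : ℂ → ℂ := fun w => if w = 0 then c else G (p + w⁻¹) with hu
  have hu0 : ∀ w, ‖u w - u 0‖ ≤ k * ‖w‖ := by
    intro w
    by_cases hw : w = 0
    · simp [hw]
    · have := hGc (p + w⁻¹)
      rw [add_sub_cancel_left, norm_inv, ← div_eq_mul_inv, div_le_iff₀ (norm_pos_iff.2 hw)] at this
      simpa [hu, hw] using this
  have hlip : ∀ w₁ w₂, ‖u w₁ - u w₂‖ ≤ k * ‖w₁ - w₂‖ := by
    intro w₁ w₂
    by_cases h₁ : w₁ = 0
    · rw [h₁, norm_sub_rev, zero_sub, norm_neg]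
      exact hu0 w₂
    by_cases h₂ : w₂ = 0
    · rw [h₂, sub_zero]
      exact hu0 w₁
    have h := hGp (p + w₁⁻¹) (p + w₂⁻¹)
    have h₁' : 0 < ‖w₁‖ := norm_pos_iff.2 h₁
    have h₂' : 0 < ‖w₂‖ := norm_pos_iff.2 h₂
    rw [add_sub_add_left_eq_sub, add_sub_cancel_left, add_sub_cancel_left, inv_sub_inv h₁ h₂,
      norm_div, norm_mul, norm_inv, norm_inv, norm_sub_rev w₂] at h
    have h' : ‖G (p + w₁⁻¹) - G (p + w₂⁻¹)‖ / (‖w₁‖ * ‖w₂‖)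
        ≤ k * ‖w₁ - w₂‖ / (‖w₁‖ * ‖w₂‖) := by
      convert! h using 1 <;> field_simp
    simpa [hu, h₁, h₂] using (div_le_div_iff_of_pos_right (by positivity)).1 h'
  obtain ⟨h, hh⟩ := exists_homeomorph_id_add hk1 hlip
  refine ⟨((Homeomorph.subRight p).onePointCongr.trans sphereInv).trans h.onePointCongr, ?_, ?_⟩
  · have : (Homeomorph.subRight p).onePointCongr (p : Sphere) = ((p - p : ℂ) : Sphere) := rfl
    rw [Homeomorph.trans_apply, Homeomorph.trans_apply, this, sub_self, sphereInv_zero]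
    rfl
  · intro z hz
    have : (Homeomorph.subRight p).onePointCongr (z : Sphere) = ((z - p : ℂ) : Sphere) := rfl
    rw [Homeomorph.trans_apply, Homeomorph.trans_apply, this, sphereInv_coe (sub_ne_zero.2 hz)]
    have : h.onePointCongr (((z - p)⁻¹ : ℂ) : Sphere) = ((h (z - p)⁻¹ : ℂ) : Sphere) := rfl
    rw [this, hh]
    simp [hu, sub_ne_zero.2 hz]

/-! ### Derivatives of Lipschitz maps -/

/-- The operator norm of `v ↦ a * v + b * conj v` is at least `‖a‖ + ‖b‖`. -/
theorem norm_add_norm_le_of_forall {a b : ℂ} {M : ℝ}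
    (h : ∀ v : ℂ, ‖v‖ = 1 → ‖a * v + b * conj v‖ ≤ M) : ‖a‖ + ‖b‖ ≤ M := by
  -- For this unit vector, `a * v` and `b * conj v` are nonnegative multiples of the same `u`.
  set v : ℂ := Complex.exp (((b.arg - a.arg) / 2 : ℝ) * Complex.I) with hv
  have hn : ‖v‖ = 1 := Complex.norm_exp_ofReal_mul_I _
  set u : ℂ := Complex.exp (((b.arg + a.arg) / 2 : ℝ) * Complex.I) with hu
  have hun : ‖u‖ = 1 := Complex.norm_exp_ofReal_mul_I _
  have hcv : conj v = Complex.exp ((-((b.arg - a.arg) / 2) : ℝ) * Complex.I) := by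
    rw [hv, ← Complex.exp_conj, map_mul, Complex.conj_I, Complex.conj_ofReal]
    push_cast
    ring_nf
  have h1 : a * v = ‖a‖ * u := by
    conv_lhs => rw [← Complex.norm_mul_exp_arg_mul_I a]
    rw [mul_assoc, hv, ← Complex.exp_add, hu]
    push_cast
    ring_nf
  have h2 : b * conj v = ‖b‖ * u := by
    conv_lhs => rw [← Complex.norm_mul_exp_arg_mul_I b]
    rw [mul_assoc, hcv, ← Complex.exp_add, hu]
    push_cast
    ring_nf
  have := h v hn
  rw [h1, h2, ← add_mul, norm_mul, hun, mul_one, ← Complex.ofReal_add, Complex.norm_real] at this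
  exact (le_abs_self _).trans this

/-- The two terms are the norms of `∂` and `∂̄` of a map with real derivative `D`. -/
theorem norm_wirtinger_add_norm_wirtinger_le (D : ℂ →L[ℝ] ℂ) :
    ‖(D 1 - Complex.I * D Complex.I) / 2‖ + ‖(D 1 + Complex.I * D Complex.I) / 2‖ ≤ ‖D‖ := by
  refine norm_add_norm_le_of_forall fun v hv => ?_
  have e : (D 1 - Complex.I * D Complex.I) / 2 * v + (D 1 + Complex.I * D Complex.I) / 2 * conj v
      = D v := by
    have h : D v = v.re * D 1 + v.im * D Complex.I := by
      conv_lhs => rw [show v = v.re • (1 : ℂ) + v.im • Complex.I by simp]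
      rw [map_add, map_smul, map_smul, Complex.real_smul, Complex.real_smul]
    have hcv : conj v = v.re - v.im * Complex.I := by
      apply Complex.ext <;> simp
    rw [h, hcv]
    conv_lhs => rw [← Complex.re_add_im v]
    simp only [Complex.add_re, Complex.add_im, Complex.ofReal_re, Complex.ofReal_im,
      Complex.mul_re, Complex.mul_im, Complex.I_re, Complex.I_im]
    push_cast
    linear_combination (-(v.im : ℂ) * D Complex.I) * Complex.I_sq
  rw [e]
  simpa [hv] using D.le_opNorm v

/-- The pointwise derivative of a Lipschitz map, which exists almost everywhere, is its
distributional derivative. -/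
theorem integral_fderiv_smul_eq_neg_integral_smul_fderiv {G : ℂ → ℂ} {C : NNReal}
    (hG : LipschitzWith C G) {φ : ℂ → ℝ} (hφ : ContDiff ℝ ∞ φ) (hc : HasCompactSupport φ) (v : ℂ) :
    Integrable (fun z => (fderiv ℝ φ z v) • G z) ∧ Integrable (fun z => φ z • fderiv ℝ G z v) ∧
    ∫ z, (fderiv ℝ φ z v) • G z = - ∫ z, φ z • fderiv ℝ G z v := by
  have hφd : Differentiable ℝ φ := hφ.differentiable (by simp)
  have hi1 : Integrable fun z => (fderiv ℝ φ z v) • G z :=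
    (((hφ.continuous_fderiv (by simp)).clm_apply continuous_const).smul
      hG.continuous).integrable_of_hasCompactSupport ((hc.fderiv_apply ℝ v).smul_right)
  have hi2 : Integrable fun z => φ z • fderiv ℝ G z v := by
    refine Integrable.mono' ((hφ.continuous.integrable_of_hasCompactSupport hc).norm.mul_const
      (C * ‖v‖)) (hφ.continuous.measurable.smul
        (measurable_fderiv_apply_const ℝ G v)).aestronglyMeasurable (.of_forall fun z => ?_)
    rw [norm_smul]
    gcongr
    exact (fderiv ℝ G z).le_of_opNorm_le (norm_fderiv_le_of_lipschitz ℝ hG) v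
  have key : ∀ L : ℂ →L[ℝ] ℝ,
      L (∫ z, (fderiv ℝ φ z v) • G z) = L (- ∫ z, φ z • fderiv ℝ G z v) := by
    intro L
    obtain ⟨D, hD⟩ := hφ.lipschitzWith_of_hasCompactSupport hc (by simp)
    have h := (L.lipschitz.comp hG).integral_lineDeriv_mul_eq (μ := volume) hD hc v
    rw [map_neg, ← L.integral_comp_comm hi1, ← L.integral_comp_comm hi2, ← integral_neg]
    have e1 : ∫ z, lineDeriv ℝ (L ∘ G) z v * φ z = ∫ z, L (φ z • fderiv ℝ G z v) := by
      refine integral_congr_ae ?_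
      filter_upwards [hG.ae_differentiableAt (μ := volume)] with z hz
      have h1 : HasFDerivAt (L ∘ G) (L.comp (fderiv ℝ G z)) z :=
        L.hasFDerivAt.comp z hz.hasFDerivAt
      rw [h1.differentiableAt.lineDeriv_eq_fderiv, h1.fderiv, map_smul]
      simp [mul_comm]
    have e2 : ∫ z, lineDeriv ℝ φ z (-v) * (L ∘ G) z = - ∫ z, L ((fderiv ℝ φ z v) • G z) := by
      rw [← integral_neg]
      refine integral_congr_ae (.of_forall fun z => ?_)
      simp [(hφd z).lineDeriv_eq_fderiv, -Complex.real_smul]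
    rw [e1, e2] at h
    rw [integral_neg, h, neg_neg]
  exact ⟨hi1, hi2, Complex.ext (key Complex.reCLM) (key Complex.imCLM)⟩

/-- The derivative of a holomorphic function on an open set is its distributional derivative
there. -/
theorem integral_fderiv_smul_eq_neg_integral_smul_deriv {U : Set ℂ} {u : ℂ → ℂ} (hU : IsOpen U)
    (hu : DifferentiableOn ℂ u U) {φ : ℂ → ℝ} (hφ : ContDiff ℝ ∞ φ) (hc : HasCompactSupport φ)
    (hs : tsupport φ ⊆ U) (v : ℂ) :
    Integrable (fun z => (fderiv ℝ φ z v) • u z) ∧ Integrable (fun z => φ z • (deriv u z * v)) ∧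
    ∫ z, (fderiv ℝ φ z v) • u z = - ∫ z, φ z • (deriv u z * v) := by
  have hcont : ∀ {ψ : ℂ → ℝ} {w : ℂ → ℂ}, Continuous ψ → tsupport ψ ⊆ tsupport φ →
      ContinuousOn w U → Integrable fun z => ψ z • w z := by
    intro ψ w hψ hsub hw
    have hψc : HasCompactSupport ψ := hc.of_isClosed_subset (isClosed_tsupport ψ) hsub
    refine Continuous.integrable_of_hasCompactSupport (continuous_of_tsupport fun z hz => ?_)
      hψc.smul_right
    have hz' : z ∈ U := hs (hsub (tsupport_smul_subset_left ψ w hz))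
    exact hψ.continuousAt.smul (hw.continuousAt (hU.mem_nhds hz'))
  have hd : ∀ z ∈ U, fderiv ℝ u z v = deriv u z * v := fun z hz => by
    have h := (hu.differentiableAt (hU.mem_nhds hz)).hasDerivAt.hasFDerivAt.restrictScalars ℝ
    rw [h.fderiv]
    simp [mul_comm]
  have hsd : tsupport (fun z => fderiv ℝ φ z v) ⊆ tsupport φ := tsupport_fderiv_apply_subset ℝ v
  have hi1 : Integrable fun z => (fderiv ℝ φ z v) • u z :=
    hcont ((hφ.continuous_fderiv (by simp)).clm_apply continuous_const) hsd hu.continuousOn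
  have hi2 : Integrable fun z => φ z • (deriv u z * v) :=
    hcont hφ.continuous subset_rfl ((hu.deriv hU).continuousOn.mul continuousOn_const)
  have e : (fun z => φ z • fderiv ℝ u z v) = fun z => φ z • (deriv u z * v) := by
    funext z
    by_cases hz : z ∈ tsupport φ
    · rw [hd z (hs hz)]
    · rw [image_eq_zero_of_notMem_tsupport hz, zero_smul, zero_smul]
  refine ⟨hi1, hi2, ?_⟩
  have h := integral_smul_fderiv_eq_neg_fderiv_smul_of_integrable (μ := volume) (f := φ) (g := u)
    (v := v) hi1 (e ▸ hi2) (hcont hφ.continuous subset_rfl hu.continuousOn)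
    (fun z _ => hφ.differentiable (by simp) z)
    (fun z hz => (hu.differentiableAt (hU.mem_nhds (hs hz))).restrictScalars ℝ)
  rw [← e, h, neg_neg]

/-- If `G` is `k`-Lipschitz in the coordinate `1 / (z - p)`, then its derivative in `z` is at most
`k` times the derivative of that coordinate. -/
theorem norm_fderiv_le_mul_inv_sq {p : ℂ} {k : ℝ} {G : ℂ → ℂ}
    (hGp : ∀ z w, ‖G z - G w‖ * (‖z - p‖ * ‖w - p‖) ≤ k * ‖z - w‖) (hk0 : 0 ≤ k) {z : ℂ}
    (hz : z ≠ p) (hd : DifferentiableAt ℝ G z) : ‖fderiv ℝ G z‖ ≤ k * ‖z - p‖⁻¹ ^ 2 := by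
  have hz0 : 0 < ‖z - p‖ := norm_pos_iff.2 (sub_ne_zero.2 hz)
  refine le_of_forall_gt_imp_ge_of_dense fun M hM => ?_
  have hM0 : 0 ≤ M := le_trans (by positivity) hM.le
  refine hd.hasFDerivAt.le_of_lip' hM0 ?_
  have hcont : ContinuousAt (fun w => k * (‖w - p‖⁻¹ * ‖z - p‖⁻¹)) z :=
    continuousAt_const.mul (((continuousAt_id.sub continuousAt_const).norm.inv₀ hz0.ne').mul
      continuousAt_const)
  have hev : ∀ᶠ w in 𝓝 z, k * (‖w - p‖⁻¹ * ‖z - p‖⁻¹) < M :=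
    hcont.eventually_lt continuousAt_const (by simpa [sq] using hM)
  filter_upwards [hev, isOpen_ne.mem_nhds hz] with w hw hwp
  have hw0 : 0 < ‖w - p‖ := norm_pos_iff.2 (sub_ne_zero.2 hwp)
  calc ‖G w - G z‖ = ‖G w - G z‖ * (‖w - p‖ * ‖z - p‖) * (‖w - p‖⁻¹ * ‖z - p‖⁻¹) := by
        field_simp
    _ ≤ k * ‖w - z‖ * (‖w - p‖⁻¹ * ‖z - p‖⁻¹) := by
        exact mul_le_mul_of_nonneg_right (hGp w z) (by positivity)
    _ = k * (‖w - p‖⁻¹ * ‖z - p‖⁻¹) * ‖w - z‖ := by ring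
    _ ≤ M * ‖w - z‖ := by gcongr

/-! ### The dilatation of a pole plus a Lipschitz map -/

/-- The sum of the pole `1 / (z - p)` and a map `G` that is `k`-Lipschitz in the coordinate
`1 / (z - p)` satisfies the analytic conditions for `k`-quasiconformality. -/
theorem isQuasiconformal_of_pole_add_lipschitz {p : ℂ} {k : ℝ} (hk0 : 0 ≤ k) (hk1 : k < 1)
    {G : ℂ → ℂ} {C : NNReal} (hG : LipschitzWith C G)
    (hGp : ∀ z w, ‖G z - G w‖ * (‖z - p‖ * ‖w - p‖) ≤ k * ‖z - w‖)
    {F : Sphere → Sphere} (hF : IsHomeomorph F) (hFp : F (p : Sphere) = OnePoint.infty)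
    (hFG : ∀ z : ℂ, z ≠ p → F (z : Sphere) = (((z - p)⁻¹ + G z : ℂ) : Sphere)) :
    IsQuasiconformal k F := by
  have hU : finitePart F = {p}ᶜ := by
    ext z
    by_cases hz : z = p
    · simp [finitePart, hz, hFp]
    · simp [finitePart, hz, hFG z hz]
  have hUo : IsOpen ({p}ᶜ : Set ℂ) := isOpen_compl_singleton
  have hne : ∀ z ∈ ({p}ᶜ : Set ℂ), z - p ≠ 0 := fun z hz => sub_ne_zero.2 hz
  set u : ℂ → ℂ := fun z => (z - p)⁻¹ with hu
  have hud : DifferentiableOn ℂ u {p}ᶜ :=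
    (differentiableOn_id.sub_const p).inv hne
  have hderiv : ∀ z ∈ ({p}ᶜ : Set ℂ), ‖deriv u z‖ = ‖z - p‖⁻¹ ^ 2 := fun z hz => by
    have h : HasDerivAt u (-1 / (z - p) ^ 2) z :=
      ((hasDerivAt_id z).sub_const p).inv (hne z hz)
    rw [h.deriv]
    simp
  have haff : ∀ z ∈ ({p}ᶜ : Set ℂ), affine F z = u z + G z := fun z hz => by
    rw [affine, hFG z hz]
    rfl
  have hL2 : ∀ v, LocallyL2On (fun z => deriv u z * v + fderiv ℝ G z v) {p}ᶜ := by
    intro v K hK hKU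
    have : IsFiniteMeasure (volume.restrict K) := ⟨by simpa using hK.measure_lt_top⟩
    have hc : ContinuousOn (fun z => deriv u z * v) K :=
      ((hud.deriv hUo).continuousOn.mul continuousOn_const).mono hKU
    obtain ⟨B, hB⟩ := hK.exists_bound_of_continuousOn hc
    refine MemLp.add (MemLp.of_bound (hc.aestronglyMeasurable hK.measurableSet) B ?_)
      (MemLp.of_bound (measurable_fderiv_apply_const ℝ G v).aestronglyMeasurable (C * ‖v‖)
        (.of_forall fun z => (fderiv ℝ G z).le_of_opNorm_le (norm_fderiv_le_of_lipschitz ℝ hG) v))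
    filter_upwards [ae_restrict_mem hK.measurableSet] with z hz using hB z hz
  have hweak : ∀ v, IsWeakDerivOn {p}ᶜ v (affine F) fun z => deriv u z * v + fderiv ℝ G z v := by
    intro v φ hφ hc hs
    obtain ⟨i1, i2, e⟩ := integral_fderiv_smul_eq_neg_integral_smul_deriv hUo hud hφ hc hs v
    obtain ⟨j1, j2, e'⟩ := integral_fderiv_smul_eq_neg_integral_smul_fderiv hG hφ hc v
    have h1 : ∀ z, (fderiv ℝ φ z v) • affine F z
        = (fderiv ℝ φ z v) • u z + (fderiv ℝ φ z v) • G z := by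
      intro z
      by_cases hz : z ∈ tsupport φ
      · rw [haff z (hs hz), smul_add]
      · have : fderiv ℝ φ z v = 0 := image_eq_zero_of_notMem_tsupport
          (f := fun z => fderiv ℝ φ z v) fun h => hz (tsupport_fderiv_apply_subset ℝ v h)
        simp [this]
    simp_rw [h1, smul_add]
    rw [integral_add i1 j1, integral_add i2 j2, e, e', neg_add]
  refine ⟨hF, fun z => deriv u z * 1 + fderiv ℝ G z 1,
    fun z => deriv u z * Complex.I + fderiv ℝ G z Complex.I, ?_⟩
  rw [hU]
  refine ⟨hL2 1, hL2 Complex.I, hweak 1, hweak Complex.I, ?_⟩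
  filter_upwards [ae_restrict_mem hUo.measurableSet,
    ae_restrict_of_ae (hG.ae_differentiableAt (μ := volume))] with z hz hd
  -- With `d` the derivative of the pole and `a`, `b` the derivatives `∂G`, `∂̄G`, the claim
  -- `‖b‖ ≤ k * ‖d + a‖` follows from `‖a‖ + ‖b‖ ≤ k * ‖d‖` and `k ≤ 1`.
  set D := fderiv ℝ G z
  set d := deriv u z
  have hsum := norm_wirtinger_add_norm_wirtinger_le D
  have hDk : ‖D‖ ≤ k * ‖d‖ := by
    rw [hderiv z hz]
    exact norm_fderiv_le_mul_inv_sq hGp hk0 hz hd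
  have e1 : (d * 1 + D 1 + Complex.I * (d * Complex.I + D Complex.I)) / 2
      = (D 1 + Complex.I * D Complex.I) / 2 := by
    linear_combination (d / 2) * Complex.I_sq
  have e2 : (d * 1 + D 1 - Complex.I * (d * Complex.I + D Complex.I)) / 2
      = d + (D 1 - Complex.I * D Complex.I) / 2 := by
    linear_combination (-d / 2) * Complex.I_sq
  rw [e1, e2]
  set a := (D 1 - Complex.I * D Complex.I) / 2
  set b := (D 1 + Complex.I * D Complex.I) / 2
  have htri : ‖d‖ - ‖a‖ ≤ ‖d + a‖ := by
    simpa using norm_sub_norm_le d (-a)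
  calc ‖b‖ ≤ k * ‖d‖ - ‖a‖ := by linarith
    _ ≤ k * ‖d‖ - k * ‖a‖ := by
        gcongr
        exact mul_le_of_le_one_left (norm_nonneg _) hk1.le
    _ = k * (‖d‖ - ‖a‖) := by ring
    _ ≤ k * ‖d + a‖ := by gcongr

/-! ### The regular part of a function in the class -/

/-- The polar part of `f` is `1 / (z - p)`: the residue condition makes the singularity of the
difference at `p` removable. -/
theorem InSigma.exists_regular_part {p : ℝ} (hp : (p : ℂ) ∈ unitDisk) {f : ℂ → ℂ}
    (hf : InSigma p f) :
    ∃ g : ℂ → ℂ, DifferentiableOn ℂ g unitDisk ∧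
      ∀ z ∈ unitDisk, z ≠ (p : ℂ) → f z = (z - p)⁻¹ + g z := by
  have ho : IsOpen unitDisk := Metric.isOpen_ball
  set h : ℂ → ℂ := fun z => f z - (z - p)⁻¹ with hh
  have hd : DifferentiableOn ℂ h (unitDisk \ {(p : ℂ)}) :=
    hf.holomorphic.sub ((differentiableOn_id.sub_const _).inv fun z hz => sub_ne_zero.2 hz.2)
  have hlit : (fun z => h z - h p) =o[𝓝[≠] (p : ℂ)] fun z => (z - (p : ℂ))⁻¹ := by
    rw [Asymptotics.isLittleO_iff_tendsto' (by
      filter_upwards [self_mem_nhdsWithin] with z hz hz'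
      exact absurd (inv_eq_zero.1 hz') (sub_ne_zero.2 hz))]
    have ht : Tendsto (fun z : ℂ => (z - p)) (𝓝[≠] (p : ℂ)) (𝓝 0) := by
      have : ContinuousAt (fun z : ℂ => (z - p)) p := by fun_prop
      simpa [ContinuousAt] using this.tendsto.mono_left nhdsWithin_le_nhds
    have := (hf.residue_one.sub_const 1).sub (ht.mul_const (h p))
    rw [zero_mul, sub_self, sub_zero] at this
    refine this.congr' ?_
    filter_upwards [self_mem_nhdsWithin] with z hz
    have : z - p ≠ 0 := sub_ne_zero.2 hz
    simp only [hh]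
    field_simp
  refine ⟨_, Complex.differentiableOn_update_limUnder_of_isLittleO (ho.mem_nhds hp) hd hlit, ?_⟩
  intro z _ hz
  simp [Function.update_of_ne hz, hh]

/-- Since `(z - p) ^ 2 * f' z + 1 = (z - p) ^ 2 * g' z`, the hypothesis on `f` bounds `g'` off `p`;
at `p` the bound follows by continuity of `g'`. -/
theorem norm_deriv_regular_part_le {p k : ℝ} {f g : ℂ → ℂ}
    (hg : DifferentiableOn ℂ g unitDisk)
    (hfg : ∀ z ∈ unitDisk, z ≠ (p : ℂ) → f z = (z - p)⁻¹ + g z)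
    (hbound : ∀ z ∈ unitDisk, z ≠ (p : ℂ) →
      ‖(z - p) ^ 2 * deriv f z + 1‖ ≤ k * ‖z - p‖ ^ 2 / (1 + p) ^ 2) :
    ∀ z ∈ unitDisk, ‖deriv g z‖ ≤ k / (1 + p) ^ 2 := by
  have ho : IsOpen unitDisk := Metric.isOpen_ball
  have off : ∀ z ∈ unitDisk, z ≠ (p : ℂ) → ‖deriv g z‖ ≤ k / (1 + p) ^ 2 := by
    intro z hz hzp
    have hne : z - p ≠ 0 := sub_ne_zero.2 hzp
    have hev : f =ᶠ[𝓝 z] fun z => (z - p)⁻¹ + g z := by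
      filter_upwards [ho.mem_nhds hz, isOpen_ne.mem_nhds hzp] with w hw hwp using hfg w hw hwp
    have hd : HasDerivAt f (-1 / (z - p) ^ 2 + deriv g z) z :=
      ((((hasDerivAt_id z).sub_const (p : ℂ)).inv hne).add
        (hg.differentiableAt (ho.mem_nhds hz)).hasDerivAt).congr_of_eventuallyEq hev
    have h := hbound z hz hzp
    have e : (z - p) ^ 2 * (-1 / (z - p) ^ 2 + deriv g z) + 1 = (z - p) ^ 2 * deriv g z := by
      field_simp
      ring
    rw [hd.deriv, e, norm_mul, norm_pow, mul_comm k, mul_div_assoc] at h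
    exact le_of_mul_le_mul_left h (pow_pos (norm_pos_iff.2 hne) 2)
  intro z hz
  by_cases hzp : z = p
  · have hc : ContinuousAt (deriv g) z :=
      (hg.deriv ho).continuousOn.continuousAt (ho.mem_nhds hz)
    refine le_of_tendsto (hc.norm.tendsto.mono_left (nhdsWithin_le_nhds (s := {z}ᶜ))) ?_
    filter_upwards [self_mem_nhdsWithin, nhdsWithin_le_nhds (ho.mem_nhds hz)] with w hw hwd
    exact off w hwd (hzp ▸ hw)
  · exact off z hz hzp

/-- A holomorphic function on the disk with derivative bounded by `L` extends to an `L`-Lipschitz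
function on the closed disk. -/
theorem exists_lipschitzOnWith_closedBall {g : ℂ → ℂ} (hg : DifferentiableOn ℂ g unitDisk)
    {L : NNReal} (hL : ∀ z ∈ unitDisk, ‖deriv g z‖ ≤ L) :
    ∃ g' : ℂ → ℂ, LipschitzOnWith L g' (Metric.closedBall 0 1) ∧ Set.EqOn g g' unitDisk := by
  have hlip : LipschitzOnWith L g unitDisk :=
    (convex_ball 0 1).lipschitzOnWith_of_nnnorm_deriv_le
      (fun z hz => hg.differentiableAt (Metric.isOpen_ball.mem_nhds hz))
      fun z hz => hL z hz
  -- This extension only has a worse Lipschitz constant, but continuity suffices to recover `L` on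
  -- the closure of the disk.
  obtain ⟨g', hg', he⟩ := hlip.extend_finite_dimension
  refine ⟨g', ?_, he⟩
  rw [← closure_ball (0 : ℂ) one_ne_zero]
  exact LipschitzOnWith.closure hg'.continuous.continuousOn fun z hz w hw => by
    simpa only [he hz, he hw] using hlip hz hw

end QCExt

theorem theorem4 (p k : ℝ) (hp0 : 0 ≤ p) (hp1 : p < 1) (hk0 : 0 ≤ k) (hk1 : k < 1)
    (f : ℂ → ℂ) (hf : QCExt.InSigma p f)
    (hbound : ∀ z ∈ QCExt.unitDisk, z ≠ (p : ℂ) →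
      ‖(z - p) ^ 2 * deriv f z + 1‖ ≤ k * ‖z - p‖ ^ 2 / (1 + p) ^ 2) :
    QCExt.InSigmaK k p f := by
  have hpD : (p : ℂ) ∈ QCExt.unitDisk := by
    simpa [QCExt.unitDisk, abs_of_nonneg hp0] using hp1
  obtain ⟨g, hg, hfg⟩ := hf.exists_regular_part hpD
  obtain ⟨L, hL⟩ : ∃ L : NNReal, (L : ℝ) = k / (1 + p) ^ 2 := ⟨⟨_, by positivity⟩, rfl⟩
  have hLk : (L : ℝ) * (1 + p) ^ 2 = k := by
    rw [hL]
    field_simp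
  obtain ⟨g', hg', he⟩ := QCExt.exists_lipschitzOnWith_closedBall hg (L := L) (by
    rw [hL]
    exact QCExt.norm_deriv_regular_part_le hg hfg hbound)
  have hr : ∀ z, QCExt.reflect z ∈ Metric.closedBall (0 : ℂ) 1 := fun z => by
    simpa using QCExt.norm_reflect_le_one z
  set G : ℂ → ℂ := fun z => g' (QCExt.reflect z) with hGdef
  have hGr : ∀ z w, ‖G z - G w‖ ≤ L * ‖QCExt.reflect z - QCExt.reflect w‖ := fun z w => by
    simpa [dist_eq_norm] using hg'.dist_le_mul _ (hr z) _ (hr w)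
  have hG : LipschitzWith (L * 1) G := by
    refine LipschitzWith.of_dist_le_mul fun z w => ?_
    rw [dist_eq_norm, NNReal.coe_mul, mul_assoc, ← dist_eq_norm]
    refine (dist_eq_norm (G z) (G w) ▸ hGr z w).trans ?_
    gcongr
    rw [← dist_eq_norm]
    exact QCExt.lipschitzWith_reflect.dist_le_mul z w
  have hGp : ∀ z w, ‖G z - G w‖ * (‖z - p‖ * ‖w - p‖) ≤ k * ‖z - w‖ := fun z w =>
    calc ‖G z - G w‖ * (‖z - p‖ * ‖w - p‖)
        ≤ L * ‖QCExt.reflect z - QCExt.reflect w‖ * (‖z - p‖ * ‖w - p‖) := by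
          gcongr
          exact hGr z w
      _ = L * (‖QCExt.reflect z - QCExt.reflect w‖ * (‖z - p‖ * ‖w - p‖)) := by ring
      _ ≤ L * ((1 + p) ^ 2 * ‖z - w‖) := by
          exact mul_le_mul_of_nonneg_left (QCExt.norm_reflect_sub_mul_le hp0 z w) L.coe_nonneg
      _ = k * ‖z - w‖ := by rw [← hLk]; ring
  have hG0 : ∀ z, ‖G z - g' 0‖ * ‖z - p‖ ≤ k := fun z =>
    calc ‖G z - g' 0‖ * ‖z - p‖ ≤ L * ‖QCExt.reflect z‖ * ‖z - p‖ := by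
          gcongr
          simpa [dist_eq_norm] using hg'.dist_le_mul _ (hr z) 0 (by simp)
      _ = L * (‖QCExt.reflect z‖ * ‖z - p‖) := by ring
      _ ≤ L * (1 + p) ^ 2 := by
          gcongr
          exact QCExt.norm_reflect_mul_le hp0 z
      _ = k := hLk
  obtain ⟨F, hFp, hFG⟩ := QCExt.exists_homeomorph_sphere hk1 hGp hG0
  refine ⟨hf, F, QCExt.isQuasiconformal_of_pole_add_lipschitz hk0 hk1 hG hGp F.isHomeomorph hFp
    hFG, fun z hz => ?_⟩
  by_cases hzp : z = p
  · rw [hzp, hFp, QCExt.withPole, if_pos rfl]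
  · have hz1 : ‖z‖ ≤ 1 := by
      simpa using Metric.ball_subset_closedBall hz
    rw [hFG z hzp, QCExt.withPole, if_neg hzp, hfg z hz hzp, he hz, hGdef]
    simp only [QCExt.reflect_of_norm_le hz1]
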